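/- Let $F(x,y)$ be a complex binary form (a homogeneous polynomial of degree $n$ in two variables) that is nonsingular, i.e. its symmetry group $G_F=\{A\in GL(2,\mathbb C): F(A\mathbf x)=F(\mathbf x)\}$ is finite, and let $\Gamma_F$ be its projective symmetry group, the image of $G_F$ in $GL(2,\mathbb C)/\{\lambda I\}$. Put $$H=F_{xx}F_{yy}-F_{xy}^2,\qquad T=F_xH_y-F_yH_x,\qquad U=F_xT_y-F_yT_x,$$ write $Q(p)=Q(p,1)$ for the inhomogeneous version of a form $Q$, and let $$J(p)=\frac{T(p)^2}{H(p)^3},\qquad K(p)=\frac{U(p)}{H(p)^2}.$$ Let $D\subseteq\mathbb C$ be a nonempty connected open set and $\varphi\colon D\to\mathbb C$ a complex analytic function. Then $P=\varphi(p)$ is a solution on $D$ of the rational symmetry equations $$J(P)=J(p),\qquad K(P)=K(p)$$ if and only if $\varphi$ is a linear fractional transformation $$\varphi(p)=\frac{\alpha p+\beta}{\gamma p+\delta},\qquad \gamma p+\delta\neq0\quad(p\in D),$$ where the class of $\begin{pmatrix}\alpha&\beta\\ \gamma&\delta\end{pmatrix}\in GL(2,\mathbb C)$ belongs to $\Gamma_F$.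 Here $\varphi$ is called a solution on $D$ if $H(p)\ne0$ and $H(\varphi(p))\neq 0$ for at least one $p\in D$, and both equations hold at every such $p\in D$. -/

import Mathlib

noncomputable section

namespace BinaryForm

open MvPolynomial

/-- The symmetry group `G_F` of a binary form `F`: all `A ∈ GL(2, ℂ)` with `F (A x) = F x`. -/
def symmetryGroup (F : MvPolynomial (Fin 2) ℂ) : Subgroup (GL (Fin 2) ℂ) where
  carrier := {A | ∀ x : Fin 2 → ℂ, eval ((A : Matrix (Fin 2) (Fin 2) ℂ).mulVec x) F = eval x F}
  one_mem' := by
    intro x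
    simp
  mul_mem' := by
    intro A B hA hB x
    rw [Units.val_mul, ← Matrix.mulVec_mulVec, hA, hB]
  inv_mem' := by
    intro A hA x
    rw [← hA, Matrix.mulVec_mulVec, ← Units.val_mul, mul_inv_cancel, Units.val_one,
      Matrix.one_mulVec]

/-- The projective symmetry group `Γ_F`: the image of `G_F` in `GL(2, ℂ)` modulo scalars. -/
def projectiveSymmetryGroup (F : MvPolynomial (Fin 2) ℂ) :
    Subgroup (Matrix.ProjGenLinGroup (Fin 2) ℂ) :=
  (symmetryGroup F).map Matrix.ProjGenLinGroup.mk

/-- A form is nonsingular if its symmetry group is finite. -/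
def Nonsingular (F : MvPolynomial (Fin 2) ℂ) : Prop :=
  Finite (symmetryGroup F)

/-- The Jacobian `F_x Q_y - F_y Q_x`, with `x` the variable `0` and `y` the variable `1`. -/
def jacobian (F Q : MvPolynomial (Fin 2) ℂ) : MvPolynomial (Fin 2) ℂ :=
  pderiv 0 F * pderiv 1 Q - pderiv 1 F * pderiv 0 Q

/-- The covariant `H = F_xx F_yy - F_xy ^ 2`. -/
def covH (F : MvPolynomial (Fin 2) ℂ) : MvPolynomial (Fin 2) ℂ :=
  pderiv 0 (pderiv 0 F) * pderiv 1 (pderiv 1 F) - pderiv 1 (pderiv 0 F) ^ 2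

/-- The covariant `T = F_x H_y - F_y H_x`. -/
def covT (F : MvPolynomial (Fin 2) ℂ) : MvPolynomial (Fin 2) ℂ :=
  jacobian F (covH F)

/-- The covariant `U = F_x T_y - F_y T_x`. -/
def covU (F : MvPolynomial (Fin 2) ℂ) : MvPolynomial (Fin 2) ℂ :=
  jacobian F (covT F)

/-- The inhomogeneous version `q(p) = Q(p, 1)` of a form `Q`. -/
def inhom (Q : MvPolynomial (Fin 2) ℂ) (p : ℂ) : ℂ :=
  eval ![p, 1] Q

/-- The rational covariant `J = T ^ 2 / H ^ 3` (meaningful where `H(p) ≠ 0`). -/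
def invJ (F : MvPolynomial (Fin 2) ℂ) (p : ℂ) : ℂ :=
  inhom (covT F) p ^ 2 / inhom (covH F) p ^ 3

/-- The rational covariant `K = U / H ^ 2` (meaningful where `H(p) ≠ 0`). -/
def invK (F : MvPolynomial (Fin 2) ℂ) (p : ℂ) : ℂ :=
  inhom (covU F) p / inhom (covH F) p ^ 2

/-- `P = φ(p)` solves the rational symmetry equations `J(P) = J(p)`, `K(P) = K(p)` on `D`:
the two sides are not everywhere undefined on `D`, and the equations hold wherever `J` and `K`
are defined at both `p` and `φ(p)`. The first clause excludes constant maps into the zero set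
of `H`, for which `J(φ(p))` and `K(φ(p))` would make sense nowhere. -/
def SolvesSymmetryEquations (F : MvPolynomial (Fin 2) ℂ) (D : Set ℂ) (φ : ℂ → ℂ) : Prop :=
  (∃ p ∈ D, inhom (covH F) p ≠ 0 ∧ inhom (covH F) (φ p) ≠ 0) ∧
  ∀ p ∈ D, inhom (covH F) p ≠ 0 → inhom (covH F) (φ p) ≠ 0 →
    invJ F (φ p) = invJ F p ∧ invK F (φ p) = invK F p

/-- On `D`, the map `φ` is the linear fractional transformation `p ↦ (α p + β) / (γ p + δ)`
attached to the class `g` of the matrix `A = (α, β; γ, δ)`, with no pole on `D`. -/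
def IsLinearFractionalOn (g : Matrix.ProjGenLinGroup (Fin 2) ℂ) (D : Set ℂ) (φ : ℂ → ℂ) : Prop :=
  ∃ A : GL (Fin 2) ℂ, Matrix.ProjGenLinGroup.mk A = g ∧
    ∀ p ∈ D, A 1 0 * p + A 1 1 ≠ 0 ∧ φ p = (A 0 0 * p + A 0 1) / (A 1 0 * p + A 1 1)

end BinaryForm

end

noncomputable section

namespace BinaryForm

open MvPolynomial

/-! Write f, h, t, u for the dehomogenized F, H, T, U, and n = k + 2 for the degree. If F ∘ A = F,
then H, T, U at p and at φ(p) differ by powers of det A and of γp + δ that cancel in J and K; this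
is the easy direction, `solves_of_isLinearFractionalOn`.

Conversely, `covT_hasDerivAt_syzygy` says n f h J' = t (3J - 2K). Differentiating J ∘ φ = J and
cancelling 3J - 2K, which takes the same value at p and φ(p), gives φ' t(φ) / (f(φ) h(φ)) = t / (f
h); squaring and dividing by J gives φ'² h(φ) / f(φ)² = h / f² (`symmetryEquations_regular`).
Together these determine the logarithmic derivative of f ∘ φ (`logDeriv_of_symmetryEquations`).
Since h is an expression in f, f', f'', one more differentiation makes the Schwarzian of φ vanish,
so φ is linear fractional near a point, and on all of D by the identity theorem. Integrating the
logarithmic derivative gives F ∘ A = c F, and an n-th root rescales c away.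

The cancellation needs J nonconstant, and this is where nonsingularity enters. If H ≡ 0
(`covH_ne_zero`) or J is constant (`not_nonsingular_of_invJ_const`), explicit integration yields a
nonzero linear vector field annihilating F, whose flow makes G_F infinite. -/

/-! ### Dehomogenization and homogeneity of the covariants. -/

/-- The chain rule for a polynomial in two variables along a differentiable curve. -/
lemma hasDerivAt_eval (Q : MvPolynomial (Fin 2) ℂ) {x : ℂ → Fin 2 → ℂ} {x' : Fin 2 → ℂ} {s : ℂ}
    (hx : ∀ i, HasDerivAt (fun u => x u i) (x' i) s) :
    HasDerivAt (fun u => eval (x u) Q)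
      (eval (x s) (pderiv 0 Q) * x' 0 + eval (x s) (pderiv 1 Q) * x' 1) s := by
  induction Q using MvPolynomial.induction_on with
  | C a => simpa using hasDerivAt_const s a
  | add p q hp hq =>
    simp only [map_add]
    exact (hp.add hq).congr_deriv (by ring)
  | mul_X p i hp =>
    simp only [map_mul, eval_X]
    refine (hp.mul (hx i)).congr_deriv ?_
    fin_cases i <;> simp [pderiv_X] <;> ring

lemma hasDerivAt_inhom (Q : MvPolynomial (Fin 2) ℂ) (p : ℂ) :
    HasDerivAt (inhom Q) (inhom (pderiv 0 Q) p) p := by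
  have h := hasDerivAt_eval Q (x := fun p => ![p, 1]) (x' := ![1, 0]) (s := p) (by
    intro i
    fin_cases i
    · exact hasDerivAt_id p
    · exact hasDerivAt_const p (1 : ℂ))
  exact h.congr_deriv (by simp [inhom])

lemma analyticAt_inhom (Q : MvPolynomial (Fin 2) ℂ) (p : ℂ) : AnalyticAt ℂ (inhom Q) p := by
  have h : Differentiable ℂ (inhom Q) := fun p => (hasDerivAt_inhom Q p).differentiableAt
  exact h.analyticAt p

lemma inhom_mul (P Q : MvPolynomial (Fin 2) ℂ) (p : ℂ) :
    inhom (P * Q) p = inhom P p * inhom Q p := by simp [inhom]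

/-- Euler's identity, dehomogenized. -/
lemma inhom_pderiv_one {Q : MvPolynomial (Fin 2) ℂ} {m : ℕ} (hQ : Q.IsHomogeneous m) (p : ℂ) :
    inhom (pderiv 1 Q) p = m * inhom Q p - p * inhom (pderiv 0 Q) p := by
  have h := congrArg (eval ![p, 1]) hQ.sum_X_mul_pderiv
  simp only [Fin.sum_univ_two, map_add, map_mul, eval_X, nsmul_eq_mul, map_natCast] at h
  simp only [Matrix.cons_val_zero, Matrix.cons_val_one] at h
  simp only [inhom]
  linear_combination h

lemma inhom_jacobian {F Q : MvPolynomial (Fin 2) ℂ} {n m : ℕ} (hF : F.IsHomogeneous n)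
    (hQ : Q.IsHomogeneous m) (p : ℂ) :
    inhom (jacobian F Q) p =
      m * inhom (pderiv 0 F) p * inhom Q p - n * inhom F p * inhom (pderiv 0 Q) p := by
  have h1 := inhom_pderiv_one hF p
  have h2 := inhom_pderiv_one hQ p
  have h : inhom (jacobian F Q) p = inhom (pderiv 0 F) p * inhom (pderiv 1 Q) p
      - inhom (pderiv 1 F) p * inhom (pderiv 0 Q) p := by simp [inhom, jacobian]
  rw [h, h1, h2]
  ring

lemma pderiv_zero_pderiv_one (Q : MvPolynomial (Fin 2) ℂ) :
    pderiv 0 (pderiv 1 Q) = pderiv 1 (pderiv 0 Q) := by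
  induction Q using MvPolynomial.induction_on with
  | C a => simp
  | add p q hp hq => simp [hp, hq]
  | mul_X p i hp => fin_cases i <;> simp [pderiv_X, hp] <;> ring

lemma inhom_covH {F : MvPolynomial (Fin 2) ℂ} {k : ℕ} (hF : F.IsHomogeneous (k + 2)) (p : ℂ) :
    inhom (covH F) p = (k + 2) * (k + 1) * inhom F p * inhom (pderiv 0 (pderiv 0 F)) p
      - (k + 1) ^ 2 * inhom (pderiv 0 F) p ^ 2 := by
  have h1 := inhom_pderiv_one hF p
  have h2 := inhom_pderiv_one (hF.pderiv (i := 0)) p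
  have h3 := inhom_pderiv_one (hF.pderiv (i := 1)) p
  have h4 := pderiv_zero_pderiv_one F
  have h : inhom (covH F) p = inhom (pderiv 0 (pderiv 0 F)) p * inhom (pderiv 1 (pderiv 1 F)) p
      - inhom (pderiv 1 (pderiv 0 F)) p ^ 2 := by simp [inhom, covH]
  rw [h4] at h3
  rw [h, h3, h2, h1]
  push_cast [show k + 2 - 1 = k + 1 from rfl]
  ring

lemma isHomogeneous_jacobian {F Q : MvPolynomial (Fin 2) ℂ} {k m : ℕ}
    (hF : F.IsHomogeneous (k + 2)) (hQ : Q.IsHomogeneous m) :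
    (jacobian F Q).IsHomogeneous (m + k) := by
  cases m with
  -- The degree `m - 1` truncates here, but Q is constant and the Jacobian is 0, homogeneous of
  -- every degree. This case occurs for quadratic F, where H and T have degree 0.
  | zero =>
    rw [← totalDegree_zero_iff_isHomogeneous, totalDegree_eq_zero_iff_eq_C] at hQ
    rw [jacobian, hQ]
    simpa using isHomogeneous_zero _ _ _
  | succ j =>
    have e : j + 1 + k = (k + 2 - 1) + (j + 1 - 1) := by omega
    rw [jacobian, e]
    exact (hF.pderiv.mul hQ.pderiv).sub (hF.pderiv.mul hQ.pderiv)

lemma isHomogeneous_covH {F : MvPolynomial (Fin 2) ℂ} {k : ℕ} (hF : F.IsHomogeneous (k + 2)) :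
    (covH F).IsHomogeneous (2 * k) := by
  have e : 2 * k = (k + 2 - 1 - 1) + (k + 2 - 1 - 1) := by omega
  rw [covH, e, pow_two]
  exact (hF.pderiv.pderiv.mul hF.pderiv.pderiv).sub (hF.pderiv.pderiv.mul hF.pderiv.pderiv)

lemma isHomogeneous_covT {F : MvPolynomial (Fin 2) ℂ} {k : ℕ} (hF : F.IsHomogeneous (k + 2)) :
    (covT F).IsHomogeneous (3 * k) := by
  have h := isHomogeneous_jacobian hF (isHomogeneous_covH hF)
  rwa [show 2 * k + k = 3 * k by ring] at h

lemma isHomogeneous_covU {F : MvPolynomial (Fin 2) ℂ} {k : ℕ} (hF : F.IsHomogeneous (k + 2)) :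
    (covU F).IsHomogeneous (4 * k) := by
  have h := isHomogeneous_jacobian hF (isHomogeneous_covT hF)
  rwa [show 3 * k + k = 4 * k by ring] at h

lemma eval_smul_of_isHomogeneous {Q : MvPolynomial (Fin 2) ℂ} {m : ℕ} (hQ : Q.IsHomogeneous m)
    (c : ℂ) (x : Fin 2 → ℂ) : eval (c • x) Q = c ^ m * eval x Q := by
  simp only [eval_eq', Finset.mul_sum]
  refine Finset.sum_congr rfl fun d hd => ?_
  have h : m = ∑ i, d i := by
    rw [hQ.degree_eq_sum_deg_support hd, ← Finsupp.degree_apply, Finsupp.degree_eq_sum]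
  simp only [Fin.prod_univ_two, Pi.smul_apply, smul_eq_mul, h, Fin.sum_univ_two]
  ring

lemma eval_eq_pow_mul_inhom {Q : MvPolynomial (Fin 2) ℂ} {m : ℕ} (hQ : Q.IsHomogeneous m)
    {x : Fin 2 → ℂ} (hx : x 1 ≠ 0) : eval x Q = x 1 ^ m * inhom Q (x 0 / x 1) := by
  rw [inhom, ← eval_smul_of_isHomogeneous hQ]
  congr 1
  have : x = x 1 • ![x 0 / x 1, 1] := by
    ext i
    fin_cases i
    · simp [mul_div_cancel₀ _ hx]
    · simp
  rw [← this]

lemma eq_zero_of_inhom_eq_zero {Q : MvPolynomial (Fin 2) ℂ} {m : ℕ} (hQ : Q.IsHomogeneous m)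
    (h : ∀ p, inhom Q p = 0) : Q = 0 := by
  -- The factor `X 1` disposes of the line x 1 = 0, which dehomogenization does not see.
  have h2 : Q * X 1 = 0 := by
    refine MvPolynomial.funext fun x => ?_
    by_cases hx : x 1 = 0
    · simp [hx]
    · simp [eval_eq_pow_mul_inhom hQ hx, h]
  exact (mul_eq_zero.mp h2).resolve_right (X_ne_zero 1)

lemma inhom_eq_zero_of_frequently {Q : MvPolynomial (Fin 2) ℂ} {p₀ : ℂ}
    (h : ∃ᶠ p in nhdsWithin p₀ {p₀}ᶜ, inhom Q p = 0) (p : ℂ) : inhom Q p = 0 := by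
  have hA : AnalyticOnNhd ℂ (inhom Q) Set.univ := fun p _ => analyticAt_inhom Q p
  exact hA.eqOn_zero_of_preconnected_of_frequently_eq_zero isPreconnected_univ (Set.mem_univ p₀) h
    (Set.mem_univ p)

lemma eq_zero_of_isOpen {Q : MvPolynomial (Fin 2) ℂ} {m : ℕ} (hQ : Q.IsHomogeneous m)
    {B : Set ℂ} (hB : IsOpen B) (hne : B.Nonempty) (h : ∀ p ∈ B, inhom Q p = 0) : Q = 0 := by
  obtain ⟨p₀, hp₀⟩ := hne
  refine eq_zero_of_inhom_eq_zero hQ (inhom_eq_zero_of_frequently (p₀ := p₀) ?_)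
  refine Filter.Eventually.frequently ?_
  exact Filter.Eventually.filter_mono nhdsWithin_le_nhds
    (Filter.mem_of_superset (hB.mem_nhds hp₀) fun p hp => h p hp)

lemma exists_inhom_ne_zero {Q : MvPolynomial (Fin 2) ℂ} {m : ℕ} (hQ : Q.IsHomogeneous m)
    (h0 : Q ≠ 0) {B : Set ℂ} (hB : IsOpen B) (hne : B.Nonempty) : ∃ p ∈ B, inhom Q p ≠ 0 := by
  by_contra! h
  exact h0 (eq_zero_of_isOpen hQ hB hne h)

/-! ### Covariance under linear substitutions. -/

/-- The linear change of variables `Q ↦ Q ∘ A`. -/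
def linSubst (A : Matrix (Fin 2) (Fin 2) ℂ) :
    MvPolynomial (Fin 2) ℂ →ₐ[ℂ] MvPolynomial (Fin 2) ℂ :=
  aeval fun i => C (A i 0) * X 0 + C (A i 1) * X 1

lemma eval_linSubst (A : Matrix (Fin 2) (Fin 2) ℂ) (Q : MvPolynomial (Fin 2) ℂ) (x : Fin 2 → ℂ) :
    eval x (linSubst A Q) = eval (A.mulVec x) Q := by
  induction Q using MvPolynomial.induction_on with
  | C a => simp [linSubst]
  | add p q hp hq => simp [hp, hq]
  | mul_X p i hp =>
    rw [map_mul, map_mul, hp]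
    fin_cases i <;> simp [linSubst]

lemma isHomogeneous_linSubst (A : Matrix (Fin 2) (Fin 2) ℂ) {Q : MvPolynomial (Fin 2) ℂ} {m : ℕ}
    (hQ : Q.IsHomogeneous m) : (linSubst A Q).IsHomogeneous m := by
  have h := hQ.aeval (fun i => (C (A i 0) * X 0 + C (A i 1) * X 1 : MvPolynomial (Fin 2) ℂ))
    (n := 1)
    (fun i => (isHomogeneous_C_mul_X _ _).add (isHomogeneous_C_mul_X _ _))
  rw [one_mul] at h
  exact h

lemma pderiv_linSubst (A : Matrix (Fin 2) (Fin 2) ℂ) (Q : MvPolynomial (Fin 2) ℂ) (j : Fin 2) :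
    pderiv j (linSubst A Q) =
      C (A 0 j) * linSubst A (pderiv 0 Q) + C (A 1 j) * linSubst A (pderiv 1 Q) := by
  induction Q using MvPolynomial.induction_on with
  | C a => simp [linSubst]
  | add p q hp hq =>
    simp only [map_add, hp, hq]
    ring
  | mul_X p i hp =>
    have hX : linSubst A (X i) = C (A i 0) * X 0 + C (A i 1) * X 1 := by simp [linSubst]
    simp only [map_mul, pderiv_mul, hp, map_add, hX]
    fin_cases i <;> fin_cases j <;> simp [pderiv_X] <;> ring

lemma jacobian_linSubst (A : Matrix (Fin 2) (Fin 2) ℂ) (F Q : MvPolynomial (Fin 2) ℂ) :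
    jacobian (linSubst A F) (linSubst A Q) = C A.det * linSubst A (jacobian F Q) := by
  simp only [jacobian, pderiv_linSubst, Matrix.det_fin_two, map_sub, map_mul]
  ring

lemma jacobian_C_mul (c : ℂ) (F Q : MvPolynomial (Fin 2) ℂ) :
    jacobian F (C c * Q) = C c * jacobian F Q := by
  simp only [jacobian, pderiv_C_mul]
  ring

/-- The Hessian matrix becomes Aᵀ (Hess F ∘ A) A, whence two factors det A; each further Jacobian
with F contributes one more, giving weights 3 and 4 for T and U. -/
lemma covH_linSubst (A : Matrix (Fin 2) (Fin 2) ℂ) (F : MvPolynomial (Fin 2) ℂ) :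
    covH (linSubst A F) = C (A.det ^ 2) * linSubst A (covH F) := by
  have h4 := pderiv_zero_pderiv_one F
  simp only [covH, pderiv_linSubst, Matrix.det_fin_two, map_sub, map_mul, map_add, map_pow,
    pderiv_C_mul, h4]
  ring

lemma covT_linSubst (A : Matrix (Fin 2) (Fin 2) ℂ) (F : MvPolynomial (Fin 2) ℂ) :
    covT (linSubst A F) = C (A.det ^ 3) * linSubst A (covT F) := by
  rw [covT, covH_linSubst, jacobian_C_mul, jacobian_linSubst, ← mul_assoc, ← C_mul, covT]
  ring_nf

lemma covU_linSubst (A : Matrix (Fin 2) (Fin 2) ℂ) (F : MvPolynomial (Fin 2) ℂ) :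
    covU (linSubst A F) = C (A.det ^ 4) * linSubst A (covU F) := by
  rw [covU, covT_linSubst, jacobian_C_mul, jacobian_linSubst, ← mul_assoc, ← C_mul, covU]
  ring_nf

-- Infinitesimal symmetries and local analytic tools.

attribute [local instance] Matrix.linftyOpNormedRing Matrix.linftyOpNormedAlgebra in
/-- A form annihilated by a nonzero linear vector field has an infinite symmetry group. -/
lemma not_nonsingular_of_linear_vectorField {F : MvPolynomial (Fin 2) ℂ}
    {M : Matrix (Fin 2) (Fin 2) ℂ} (hM : M ≠ 0)
    (h : ∀ x : Fin 2 → ℂ, eval x (pderiv 0 F) * M.mulVec x 0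
      + eval x (pderiv 1 F) * M.mulVec x 1 = 0) : ¬ Nonsingular F := by
  intro hfin
  let g : ℂ → Matrix (Fin 2) (Fin 2) ℂ := fun s => NormedSpace.exp (s • M)
  have hg : ∀ s, HasDerivAt g (M * g s) s := fun s => hasDerivAt_exp_smul_const' M s
  have hg0 : g 0 = 1 := by simp [g]
  have hunit : ∀ s, IsUnit (g s) := fun s => Matrix.isUnit_exp _
  have hentry : ∀ s i j, HasDerivAt (fun u => g u i j) ((M * g s) i j) s := fun s i j =>
    (Matrix.entryLinearMap ℂ ℂ i j).toContinuousLinearMap.hasFDerivAt.comp_hasDerivAt s (hg s)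
  have hinv : ∀ s x, eval ((g s).mulVec x) F = eval x F := by
    intro s x
    have hd : ∀ u, HasDerivAt (fun u => eval ((g u).mulVec x) F) 0 u := by
      intro u
      have := hasDerivAt_eval F (x := fun u => (g u).mulVec x)
        (x' := M.mulVec ((g u).mulVec x)) (s := u) (by
          intro i
          rw [Matrix.mulVec_mulVec]
          simp only [Matrix.mulVec, dotProduct, Fin.sum_univ_two]
          exact ((hentry u i 0).mul_const _).add ((hentry u i 1).mul_const _))
      rwa [h] at this
    have := is_const_of_deriv_eq_zero (fun u => (hd u).differentiableAt) (fun u => (hd u).deriv) s 0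
    simpa [hg0] using this
  have hfinite : (Set.range g).Finite := by
    have : Finite (symmetryGroup F) := hfin
    refine (Set.finite_range (fun A : symmetryGroup F => ((A : GL (Fin 2) ℂ) :
      Matrix (Fin 2) (Fin 2) ℂ))).subset ?_
    rintro _ ⟨s, rfl⟩
    exact ⟨⟨(hunit s).unit, fun x => hinv s x⟩, rfl⟩
  have hcont : Continuous g := continuous_iff_continuousAt.mpr fun s => (hg s).continuousAt
  -- A finite connected set is at most a point, so the flow is constant and its velocity M at time 0
  -- vanishes.
  have hsub : (Set.range g).Subsingleton := by
    by_contra hns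
    exact (isPreconnected_range hcont).infinite_of_nontrivial (Set.not_subsingleton_iff.mp hns)
      hfinite
  have hconst : g = fun _ => 1 := by
    funext s
    rw [← hg0]
    exact hsub ⟨s, rfl⟩ ⟨0, rfl⟩
  have h1 := hg 0
  rw [hg0, mul_one] at h1
  rw [hconst] at h1
  exact hM (h1.unique (hasDerivAt_const 0 1))

lemma eq_of_hasDerivAt_zero {B : Set ℂ} (hB : IsOpen B) (hc : IsPreconnected B) {g : ℂ → ℂ}
    (h : ∀ p ∈ B, HasDerivAt g 0 p) {p q : ℂ} (hp : p ∈ B) (hq : q ∈ B) : g p = g q :=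
  hB.is_const_of_deriv_eq_zero hc (fun x hx => (h x hx).differentiableAt.differentiableWithinAt)
    (fun x hx => (h x hx).deriv) hp hq

lemma exists_ball_of_eventually {P : ℂ → Prop} {p₀ : ℂ} (h : ∀ᶠ p in nhds p₀, P p) :
    ∃ B : Set ℂ, IsOpen B ∧ IsPreconnected B ∧ p₀ ∈ B ∧ ∀ p ∈ B, P p := by
  obtain ⟨ε, hε, hb⟩ := Metric.eventually_nhds_iff_ball.mp h
  exact ⟨Metric.ball p₀ ε, Metric.isOpen_ball, (convex_ball p₀ ε).isPreconnected,
    Metric.mem_ball_self hε, hb⟩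

/-- A nonvanishing analytic germ has an analytic square root. -/
lemma exists_analyticAt_sq_eq {z : ℂ → ℂ} {p₀ : ℂ} (hz : AnalyticAt ℂ z p₀) (h0 : z p₀ ≠ 0) :
    ∃ y : ℂ → ℂ, AnalyticAt ℂ y p₀ ∧ ∀ᶠ p in nhds p₀, y p ^ 2 = z p := by
  obtain ⟨s, hs⟩ := IsAlgClosed.exists_pow_nat_eq (z p₀) (n := 2) two_pos
  -- Dividing by `z p₀` moves the value at p₀ to 1, away from the branch cut of the logarithm.
  refine ⟨fun p => s * Complex.exp (1 / 2 * Complex.log (z p / z p₀)), ?_, ?_⟩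
  · refine analyticAt_const.mul (AnalyticAt.cexp (analyticAt_const.mul (AnalyticAt.clog ?_ ?_)))
    · exact hz.div analyticAt_const h0
    · simp [div_self h0]
  · filter_upwards [hz.continuousAt.eventually_ne h0] with p hp
    rw [mul_pow, hs, ← Complex.exp_nat_mul]
    have : ((2 : ℕ) : ℂ) * (1 / 2 * Complex.log (z p / z p₀)) = Complex.log (z p / z p₀) := by
      push_cast
      ring
    rw [this, Complex.exp_log (div_ne_zero hp h0), mul_div_cancel₀ _ h0]

/-- The derivative of F along the linear field M is itself a form, so its dehomogenization need only
vanish on an open set. -/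
lemma not_nonsingular_of_affine_vectorField {F : MvPolynomial (Fin 2) ℂ} {n : ℕ}
    (hF : F.IsHomogeneous n) {M : Matrix (Fin 2) (Fin 2) ℂ} (hM : M ≠ 0) {B : Set ℂ}
    (hB : IsOpen B) (hne : B.Nonempty)
    (h : ∀ p ∈ B, inhom (pderiv 0 F) p * (M 0 0 * p + M 0 1)
      + inhom (pderiv 1 F) p * (M 1 0 * p + M 1 1) = 0) : ¬ Nonsingular F := by
  have hL : ∀ i, (C (M i 0) * X 0 + C (M i 1) * X 1 : MvPolynomial (Fin 2) ℂ).IsHomogeneous 1 :=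
    fun i => (isHomogeneous_C_mul_X _ _).add (isHomogeneous_C_mul_X _ _)
  have h0 := eq_zero_of_isOpen
    ((hF.pderiv (i := 0)).mul (hL 0) |>.add ((hF.pderiv (i := 1)).mul (hL 1))) hB hne
    (fun p hp => by simpa [inhom] using h p hp)
  refine not_nonsingular_of_linear_vectorField hM fun x => ?_
  have h1 := congrArg (eval x) h0
  simpa [Matrix.mulVec, dotProduct, Fin.sum_univ_two] using h1

lemma not_nonsingular_of_le_one {F : MvPolynomial (Fin 2) ℂ} {n : ℕ}
    (hF : F.IsHomogeneous n) (hn : n ≤ 1) : ¬ Nonsingular F := by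
  have key : ∀ i, ∃ a, pderiv i F = C a := by
    intro i
    have h := hF.pderiv (i := i)
    rw [Nat.sub_eq_zero_of_le hn, ← totalDegree_zero_iff_isHomogeneous,
      totalDegree_eq_zero_iff_eq_C] at h
    exact ⟨_, h⟩
  obtain ⟨a, ha⟩ := key 0
  obtain ⟨b, hb⟩ := key 1
  by_cases h : a = 0 ∧ b = 0
  · refine not_nonsingular_of_linear_vectorField (M := 1) one_ne_zero fun x => ?_
    simp [ha, hb, h.1, h.2]
  -- The gradient is the constant (a, b), and the field x 0 • (b, -a) is orthogonal to it.
  · refine not_nonsingular_of_linear_vectorField (M := !![b, 0; -a, 0]) (fun h0 => h ?_) fun x => ?_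
    · have h1 := congrFun (congrFun h0 0) 0
      have h2 := congrFun (congrFun h0 1) 0
      simp at h1 h2
      exact ⟨h2, h1⟩
    · simp [ha, hb, Matrix.mulVec, dotProduct, Fin.sum_univ_two]
      ring

/-! ### Nonsingular forms have H ≢ 0 and J nonconstant. -/

/-- The Hessian of a nonsingular form does not vanish identically. -/
lemma covH_ne_zero {F : MvPolynomial (Fin 2) ℂ} {k : ℕ} (hF : F.IsHomogeneous (k + 2))
    (hns : Nonsingular F) : covH F ≠ 0 := by
  intro hH
  have hk1 : (k : ℂ) + 1 ≠ 0 := Nat.cast_add_one_ne_zero k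
  by_cases hf1 : pderiv 0 F = 0
  · refine not_nonsingular_of_linear_vectorField (M := !![1, 0; 0, 0]) (fun h0 => ?_)
      (fun x => ?_) hns
    · simpa using congrFun (congrFun h0 0) 0
    · simp [hf1, Matrix.mulVec, dotProduct, Fin.sum_univ_two]
  obtain ⟨p₀, -, hp₀⟩ := exists_inhom_ne_zero hF.pderiv hf1 isOpen_univ Set.univ_nonempty
  obtain ⟨B, hB, hBc, hpB, hf1B⟩ := exists_ball_of_eventually
    ((analyticAt_inhom (pderiv 0 F) p₀).continuousAt.eventually_ne hp₀)
  -- By Euler's identity r = F_y / F_x on y = 1, and r' = -h / ((n - 1) f'²), so H ≡ 0 makes the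
  -- ratio constant.
  let r : ℂ → ℂ := fun p => (k + 2) * inhom F p / inhom (pderiv 0 F) p - p
  have hr : ∀ p ∈ B, HasDerivAt r 0 p := by
    intro p hp
    have hd := (((hasDerivAt_inhom F p).const_mul ((k : ℂ) + 2)).div
      (hasDerivAt_inhom (pderiv 0 F) p) (hf1B p hp)).sub (hasDerivAt_id p)
    refine hd.congr_deriv ?_
    have h := inhom_covH hF p
    have hz : inhom (covH F) p = 0 := by simp [hH, inhom]
    have hne := hf1B p hp
    field_simp
    apply mul_left_cancel₀ hk1
    linear_combination h - hz
  refine not_nonsingular_of_affine_vectorField hF (M := !![0, -r p₀; 0, 1]) (fun h0 => ?_)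
    hB ⟨p₀, hpB⟩ (fun p hp => ?_) hns
  · simpa using congrFun (congrFun h0 1) 1
  · rw [eq_of_hasDerivAt_zero hB hBc hr hpB hp, inhom_pderiv_one hF]
    have hne := hf1B p hp
    simp only [r, Matrix.of_apply, Matrix.cons_val', Matrix.cons_val_zero, Matrix.cons_val_one]
    push_cast
    simp
    field_simp
    ring

/-- The syzygy governing the derivative of the invariant `J`. -/
lemma covT_hasDerivAt_syzygy {F : MvPolynomial (Fin 2) ℂ} {k : ℕ} (hF : F.IsHomogeneous (k + 2))
    (p : ℂ) : (k + 2) * inhom F p * (2 * inhom (covT F) p * inhom (pderiv 0 (covT F)) p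
        * inhom (covH F) p - 3 * inhom (covT F) p ^ 2 * inhom (pderiv 0 (covH F)) p) =
      inhom (covT F) p * (3 * inhom (covT F) p ^ 2 - 2 * inhom (covH F) p * inhom (covU F) p) := by
  have hT : inhom (covT F) p = _ := inhom_jacobian hF (isHomogeneous_covH hF) p
  have hU : inhom (covU F) p = _ := inhom_jacobian hF (isHomogeneous_covT hF) p
  push_cast at hT hU
  -- The terms in f' cancel because T² and H³ have the same degree 6k.
  linear_combination (2 * inhom (covT F) p * inhom (covH F) p) * hU
    - 3 * inhom (covT F) p ^ 2 * hT

lemma hasDerivAt_invJ {F : MvPolynomial (Fin 2) ℂ} {k : ℕ} (hF : F.IsHomogeneous (k + 2)) {p : ℂ}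
    (hf : inhom F p ≠ 0) (hh : inhom (covH F) p ≠ 0) :
    HasDerivAt (invJ F) (inhom (covT F) p * (3 * inhom (covT F) p ^ 2
      - 2 * inhom (covH F) p * inhom (covU F) p)
        / ((k + 2) * inhom F p * inhom (covH F) p ^ 4)) p := by
  have hd := ((hasDerivAt_inhom (covT F) p).pow 2).div ((hasDerivAt_inhom (covH F) p).pow 3)
    (pow_ne_zero 3 hh)
  refine hd.congr_deriv ?_
  have hk : (k : ℂ) + 2 ≠ 0 := by exact_mod_cast Nat.succ_ne_zero (k + 1)
  rw [← covT_hasDerivAt_syzygy hF]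
  field_simp
  simp
  ring

/-- If `J` is constant then `F` is annihilated by a nonzero linear vector field. -/
lemma not_nonsingular_of_invJ_const {F : MvPolynomial (Fin 2) ℂ} {k : ℕ}
    (hF : F.IsHomogeneous (k + 2)) (hF0 : F ≠ 0) (hH0 : covH F ≠ 0)
    (hW : ∀ p, inhom (covT F) p * (3 * inhom (covT F) p ^ 2
      - 2 * inhom (covH F) p * inhom (covU F) p) = 0) : ¬ Nonsingular F := by
  have hk1 : (k : ℂ) + 1 ≠ 0 := Nat.cast_add_one_ne_zero k
  have hk : (k : ℂ) + 2 ≠ 0 := by exact_mod_cast Nat.succ_ne_zero (k + 1)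
  obtain ⟨p₀, -, hp₀⟩ := exists_inhom_ne_zero (hF.mul (isHomogeneous_covH hF))
    (mul_ne_zero hF0 hH0) isOpen_univ Set.univ_nonempty
  rw [inhom_mul] at hp₀
  -- y is a local branch of f / √h. It will turn out to be a quadratic polynomial, the vector field
  -- on the affine line induced by the matrix sought.
  obtain ⟨y, hya, hy⟩ := exists_analyticAt_sq_eq
    (((analyticAt_inhom F p₀).pow 2).div (analyticAt_inhom (covH F) p₀) (right_ne_zero_of_mul hp₀))
    (div_ne_zero (pow_ne_zero 2 (left_ne_zero_of_mul hp₀)) (right_ne_zero_of_mul hp₀))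
  obtain ⟨B, hB, hBc, hpB, hall⟩ := exists_ball_of_eventually
    (((analyticAt_inhom F p₀).continuousAt.eventually_ne (left_ne_zero_of_mul hp₀)).and
    (((analyticAt_inhom (covH F) p₀).continuousAt.eventually_ne (right_ne_zero_of_mul hp₀)).and
      (hya.eventually_analyticAt.and hy)))
  choose hf hh hyA hy2 using hall
  have hyB : AnalyticOnNhd ℂ y B := hyA
  have hd0 : ∀ p ∈ B, HasDerivAt y (deriv y p) p := fun p hp =>
    (hyB p hp).differentiableAt.hasDerivAt
  have hd1 : ∀ p ∈ B, HasDerivAt (deriv y) (deriv (deriv y) p) p := fun p hp =>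
    (hyB.deriv p hp).differentiableAt.hasDerivAt
  have hd2 : ∀ p ∈ B, HasDerivAt (deriv (deriv y)) (deriv (deriv (deriv y)) p) p := fun p hp =>
    (hyB.deriv.deriv p hp).differentiableAt.hasDerivAt
  have hyh : ∀ p ∈ B, y p ^ 2 * inhom (covH F) p = inhom F p ^ 2 := fun p hp => by
    rw [hy2 p hp]
    exact div_mul_cancel₀ _ (hh p hp)
  have hy0 : ∀ p ∈ B, y p ≠ 0 := fun p hp h0 => by
    have := hyh p hp
    rw [h0] at this
    exact pow_ne_zero 2 (hf p hp) (by rw [← this]; ring)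
  have hyh' : ∀ p ∈ B, 2 * y p * deriv y p * inhom (covH F) p
      + y p ^ 2 * inhom (pderiv 0 (covH F)) p = 2 * inhom F p * inhom (pderiv 0 F) p := by
    intro p hp
    have e := ((hd0 p hp).pow 2).mul (hasDerivAt_inhom (covH F) p)
    have e2 := ((hasDerivAt_inhom F p).pow 2)
    have := (e2.congr_of_eventuallyEq
      (Filter.eventuallyEq_of_mem (hB.mem_nhds hp) fun q hq => hyh q hq)).unique e
    simp at this
    linear_combination -this
  -- e equals -t / (4 h^(3/2)) for the chosen root, so e² = J / 16 is constant.
  let e : ℂ → ℂ := fun p => inhom (pderiv 0 F) p / inhom F p * y p - (k + 2) / 2 * deriv y p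
  have het : ∀ p ∈ B, e p = - (y p * inhom (covT F) p / (4 * inhom (covH F) p * inhom F p)) := by
    intro p hp
    have hT : inhom (covT F) p = _ := inhom_jacobian hF (isHomogeneous_covH hF) p
    push_cast at hT
    have h1 := hyh p hp
    have h2 := hyh' p hp
    have nf := hf p hp
    have nh := hh p hp
    have ny := hy0 p hp
    rw [hT]
    simp only [e]
    field_simp
    apply mul_left_cancel₀ ny
    linear_combination (-2 * (k + 2) * inhom F p) * h2
      + (4 * (k + 2)) * inhom (pderiv 0 F) p * h1
  have hJ : ∀ p ∈ B, HasDerivAt (invJ F) 0 p := fun p hp =>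
    (hasDerivAt_invJ hF (hf p hp) (hh p hp)).congr_deriv (by rw [hW, zero_div])
  have he2 : ∀ p ∈ B, e p ^ 2 = invJ F p₀ / 16 := by
    intro p hp
    rw [eq_of_hasDerivAt_zero hB hBc hJ hpB hp, het p hp, invJ]
    have h1 := hyh p hp
    have nf := hf p hp
    have nh := hh p hp
    field_simp
    linear_combination (16 * inhom (covT F) p ^ 2) * h1
  have hed : ∀ p ∈ B, DifferentiableAt ℂ e p := fun p hp =>
    ((((hasDerivAt_inhom (pderiv 0 F) p).div (hasDerivAt_inhom F p) (hf p hp)).mul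
      (hd0 p hp)).sub ((hd1 p hp).const_mul _)).differentiableAt
  -- By continuity on the connected set B, the square root e of a constant cannot change sign; the
  -- value 0 is treated apart because `eq_of_sq_eq` needs a nonvanishing comparison function.
  have hec : ∀ p ∈ B, e p = e p₀ := by
    by_cases hz : e p₀ = 0
    · intro p hp
      have : e p ^ 2 = 0 := by rw [he2 p hp, ← he2 p₀ hpB, hz]; ring
      rw [hz]
      exact pow_eq_zero_iff two_ne_zero |>.mp this
    · intro p hp
      refine hBc.eq_of_sq_eq (f := e) (g := fun _ => e p₀)
        (fun q hq => (hed q hq).continuousAt.continuousWithinAt) continuousOn_const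
        (fun q hq => ?_) (fun _ => hz) hpB rfl hp
      simp [he2 q hq, he2 p₀ hpB]
  have hu : ∀ p ∈ B, inhom (pderiv 0 F) p * y p =
      ((k + 2) / 2 * deriv y p + e p₀) * inhom F p := by
    intro p hp
    have h1 := hec p hp
    have nf := hf p hp
    rw [← h1]
    simp only [e]
    field_simp
    ring
  have hu' : ∀ p ∈ B, inhom (pderiv 0 (pderiv 0 F)) p * y p + inhom (pderiv 0 F) p * deriv y p =
      (k + 2) / 2 * deriv (deriv y) p * inhom F p
        + ((k + 2) / 2 * deriv y p + e p₀) * inhom (pderiv 0 F) p := by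
    intro p hp
    have e1 := (hasDerivAt_inhom (pderiv 0 F) p).mul (hd0 p hp)
    have e2 := (((hd1 p hp).const_mul (((k : ℂ) + 2) / 2)).add_const (e p₀)).mul
      (hasDerivAt_inhom F p)
    exact (e1.congr_of_eventuallyEq (Filter.eventuallyEq_of_mem (hB.mem_nhds hp)
      fun q hq => (hu q hq).symm)).unique e2
  -- This is y² h = f² with h written in f, f', f'' and these eliminated through `hu` and `hu'`. Its
  -- derivative is a nonzero multiple of y y''', which forces y''' = 0.
  have hq : ∀ p ∈ B, (k + 2) ^ 2 / 2 * (y p * deriv (deriv y) p)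
      - (k + 2) ^ 2 / 4 * deriv y p ^ 2 = 1 / (k + 1) - e p₀ ^ 2 := by
    intro p hp
    have h0 := hyh p hp
    have h1 := hu p hp
    have h2 := hu' p hp
    have nf := hf p hp
    rw [inhom_covH hF] at h0
    set f := inhom F p
    set f1 := inhom (pderiv 0 F) p
    set f2 := inhom (pderiv 0 (pderiv 0 F)) p
    set L := (k + 2) / 2 * deriv y p + e p₀ with hL
    have key : (k + 1) * f ^ 2 * ((k + 2) ^ 2 / 2 * (y p * deriv (deriv y) p)
        - (k + 2) ^ 2 / 4 * deriv y p ^ 2 + e p₀ ^ 2) = f ^ 2 := by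
      linear_combination h0 - (k + 1) * (k + 2) * f * y p * h2
        + (k + 1) * ((k + 1) * (f1 * y p + L * f) + (k + 2) * f * (deriv y p - L)) * h1
        + (k + 1) * f ^ 2 * (e p₀ - (k + 2) / 2 * deriv y p) * hL * (-1)
    have hf2 : f ^ 2 ≠ 0 := pow_ne_zero 2 nf
    rw [eq_sub_iff_add_eq, eq_div_iff hk1]
    apply mul_left_cancel₀ hf2
    linear_combination key
  have hy3 : ∀ p ∈ B, deriv (deriv (deriv y)) p = 0 := by
    intro p hp
    have e1 := (((hd0 p hp).mul (hd2 p hp)).const_mul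
      (((k : ℂ) + 2) ^ 2 / 2)).sub (((hd1 p hp).pow 2).const_mul (((k : ℂ) + 2) ^ 2 / 4))
    have := (e1.congr_of_eventuallyEq (Filter.eventuallyEq_of_mem (hB.mem_nhds hp)
      fun q hq' => (hq q hq').symm)).unique (hasDerivAt_const p _)
    have h2 : (k + 2) ^ 2 * y p * deriv (deriv (deriv y)) p = 0 := by
      simp at this
      linear_combination 2 * this
    exact (mul_eq_zero.mp h2).resolve_left (mul_ne_zero (pow_ne_zero 2 hk) (hy0 p hp))
  have hc2 : ∀ p ∈ B, deriv (deriv y) p₀ = deriv (deriv y) p := fun p hp =>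
    eq_of_hasDerivAt_zero hB hBc (fun q hq => (hd2 q hq).congr_deriv (hy3 q hq)) hpB hp
  set a := deriv (deriv y) p₀ with ha
  have hc1 : ∀ p ∈ B, deriv y p₀ - a * p₀ = deriv y p - a * p := fun p hp =>
    eq_of_hasDerivAt_zero hB hBc (g := fun p => deriv y p - a * p)
      (fun q hq => ((hd1 q hq).sub ((hasDerivAt_id q).const_mul a)).congr_deriv
        (by rw [hc2 q hq]; ring)) hpB hp
  set b := deriv y p₀ - a * p₀ with hb
  have hc0 : ∀ p ∈ B, y p₀ - a / 2 * p₀ ^ 2 - b * p₀ = y p - a / 2 * p ^ 2 - b * p := fun p hp =>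
    eq_of_hasDerivAt_zero hB hBc (g := fun p => y p - a / 2 * p ^ 2 - b * p)
      (fun q hq => (((hd0 q hq).sub (((hasDerivAt_id q).pow 2).const_mul (a / 2))).sub
        ((hasDerivAt_id q).const_mul b)).congr_deriv (by rw [hc1 q hq]; simp; ring)) hpB hp
  set c := y p₀ - a / 2 * p₀ ^ 2 - b * p₀ with hc
  -- M is chosen so that, after F_y = n f - p f', the condition reads y f' - (n/2 y' + e) f = 0,
  -- which is `hu`. If M were 0, its entries would give y(p₀) = 0.
  refine not_nonsingular_of_affine_vectorField hF
    (M := !![b / 2 - e p₀ / (k + 2), c; -(a / 2), -(b / 2 + e p₀ / (k + 2))]) (fun h0 => ?_)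
    hB ⟨p₀, hpB⟩ (fun p hp => ?_)
  · have m00 := congrFun (congrFun h0 0) 0
    have m01 := congrFun (congrFun h0 0) 1
    have m10 := congrFun (congrFun h0 1) 0
    have m11 := congrFun (congrFun h0 1) 1
    simp only [Matrix.of_apply, Matrix.cons_val', Matrix.cons_val_zero, Matrix.cons_val_one,
      Matrix.cons_val_fin_one, Matrix.zero_apply] at m00 m01 m10 m11
    apply hy0 p₀ hpB
    linear_combination hc.symm + m01 - p₀ ^ 2 * m10 + p₀ * m00 - p₀ * m11
  · simp only [Matrix.of_apply, Matrix.cons_val', Matrix.cons_val_zero, Matrix.cons_val_one,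
      Matrix.cons_val_fin_one]
    rw [inhom_pderiv_one hF]
    have h1 := hu p hp
    have h2 := hc0 p hp
    have h3 := hc1 p hp
    push_cast
    have h4 : y p = a / 2 * p ^ 2 + b * p + c := by linear_combination -h2
    have h5 : deriv y p = a * p + b := by linear_combination -h3
    rw [h4, h5] at h1
    field_simp
    linear_combination (2 * (k + 2)) * h1

/-! ### Solutions of the symmetry equations are linear fractional. -/

/-- A locally injective analytic function with zero Schwarzian derivative is a linear fractional
transformation. -/
lemma linearFractional_of_schwarzian_eq_zero {φ : ℂ → ℂ} {B : Set ℂ} (hB : IsOpen B)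
    (hBc : IsPreconnected B) (hφ : AnalyticOnNhd ℂ φ B) (h1 : ∀ p ∈ B, deriv φ p ≠ 0)
    (hS : ∀ p ∈ B, 2 * deriv (deriv (deriv φ)) p * deriv φ p = 3 * deriv (deriv φ) p ^ 2)
    {p₀ : ℂ} (hp₀ : p₀ ∈ B) :
    ∃ κ : ℂ, ∀ p ∈ B, deriv (deriv φ) p * (1 - κ * (p - p₀)) = 2 * κ * deriv φ p ∧
      1 - κ * (p - p₀) ≠ 0 ∧
      φ p * (1 - κ * (p - p₀)) = φ p₀ + (deriv φ p₀ - κ * φ p₀) * (p - p₀) := by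
  have hd0 : ∀ p ∈ B, HasDerivAt φ (deriv φ p) p := fun p hp =>
    (hφ p hp).differentiableAt.hasDerivAt
  have hd1 : ∀ p ∈ B, HasDerivAt (deriv φ) (deriv (deriv φ) p) p := fun p hp =>
    (hφ.deriv p hp).differentiableAt.hasDerivAt
  have hd2 : ∀ p ∈ B, HasDerivAt (deriv (deriv φ)) (deriv (deriv (deriv φ)) p) p := fun p hp =>
    (hφ.deriv.deriv p hp).differentiableAt.hasDerivAt
  obtain ⟨κ, hκ⟩ : ∃ κ, κ = deriv (deriv φ) p₀ / (2 * deriv φ p₀) := ⟨_, rfl⟩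
  have hκ0 : deriv (deriv φ) p₀ = 2 * κ * deriv φ p₀ := by
    have := h1 p₀ hp₀
    rw [hκ]
    field_simp
  have hL : ∀ p, HasDerivAt (fun p => 1 - κ * (p - p₀)) (-κ) p := fun p =>
    ((((hasDerivAt_id p).sub_const p₀).const_mul κ).const_sub 1).congr_deriv (by simp)
  -- Zero Schwarzian means that w = φ'^(-1/2) is affine. E / φ'^(3/2) is -2 times the Wronskian of w
  -- and 1 - κ(p - p₀), hence constant; squaring it below avoids choosing a root, and κ makes it
  -- vanish at p₀.
  let E : ℂ → ℂ := fun p => deriv (deriv φ) p * (1 - κ * (p - p₀)) - 2 * κ * deriv φ p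
  have hE : ∀ p ∈ B, E p = 0 := by
    intro p hp
    have hc : E p ^ 2 / deriv φ p ^ 3 = E p₀ ^ 2 / deriv φ p₀ ^ 3 := by
      refine eq_of_hasDerivAt_zero hB hBc (g := fun p => E p ^ 2 / deriv φ p ^ 3)
        (fun q hq => ?_) hp hp₀
      have hEd := (((hd2 q hq).mul (hL q)).sub ((hd1 q hq).const_mul (2 * κ))).pow 2
      refine (hEd.div ((hd1 q hq).pow 3) (pow_ne_zero 3 (h1 q hq))).congr_deriv ?_
      have := hS q hq
      have hne := h1 q hq
      simp only [Pi.sub_apply, Pi.mul_apply, Pi.pow_apply]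
      rw [div_eq_zero_iff]
      left
      push_cast
      linear_combination (deriv φ q) ^ 2 * (deriv (deriv φ) q * (1 - κ * (q - p₀))
        - 2 * κ * deriv φ q) * (1 - κ * (q - p₀)) * this
    have h0 : E p₀ = 0 := by simp [E, hκ0]
    rw [h0] at hc
    have hc' : E p ^ 2 / deriv φ p ^ 3 = 0 := by simpa using hc
    simpa [h1 p hp] using hc'
  have hG1 : ∀ p ∈ B, deriv φ p * (1 - κ * (p - p₀)) - κ * φ p = deriv φ p₀ - κ * φ p₀ := by
    intro p hp
    have := eq_of_hasDerivAt_zero hB hBc (g := fun p => deriv φ p * (1 - κ * (p - p₀)) - κ * φ p)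
      (fun q hq => (((hd1 q hq).mul (hL q)).sub ((hd0 q hq).const_mul κ)).congr_deriv
        (by linear_combination hE q hq)) hp hp₀
    simpa using this
  have hG0 : ∀ p ∈ B, φ p * (1 - κ * (p - p₀)) - (deriv φ p₀ - κ * φ p₀) * (p - p₀) = φ p₀ := by
    intro p hp
    have := eq_of_hasDerivAt_zero hB hBc
      (g := fun p => φ p * (1 - κ * (p - p₀)) - (deriv φ p₀ - κ * φ p₀) * (p - p₀))
      (fun q hq => (((hd0 q hq).mul (hL q)).sub (((hasDerivAt_id q).sub_const p₀).const_mul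
        (deriv φ p₀ - κ * φ p₀))).congr_deriv (by linear_combination hG1 q hq)) hp hp₀
    simpa using this
  refine ⟨κ, fun p hp => ⟨by linear_combination hE p hp, fun h => ?_,
    by linear_combination hG0 p hp⟩⟩
  have e1 := hE p hp
  simp only [E, h] at e1
  have hκz : κ = 0 := by simpa [h1 p hp] using e1
  simp [hκz] at h

/-- The data shared by `p` and `P = φ p` at a regular point of the symmetry equations. -/
lemma symmetryEquations_regular {F : MvPolynomial (Fin 2) ℂ} {k : ℕ}
    (hF : F.IsHomogeneous (k + 2)) {φ : ℂ → ℂ} {p : ℂ} (hφ : DifferentiableAt ℂ φ p)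
    (hh : inhom (covH F) p ≠ 0) (hhP : inhom (covH F) (φ p) ≠ 0) (hf : inhom F p ≠ 0)
    (hW : inhom (covT F) p * (3 * inhom (covT F) p ^ 2
      - 2 * inhom (covH F) p * inhom (covU F) p) ≠ 0)
    (hJ : ∀ᶠ q in nhds p, invJ F (φ q) = invJ F q) (hK : invK F (φ p) = invK F p) :
    inhom F (φ p) ≠ 0 ∧ deriv φ p ≠ 0 ∧
      inhom (covT F) (φ p) * deriv φ p * inhom (covH F) p * inhom F p
        = inhom (covT F) p * inhom (covH F) (φ p) * inhom F (φ p) ∧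
      deriv φ p ^ 2 * inhom (covH F) (φ p) * inhom F p ^ 2
        = inhom (covH F) p * inhom F (φ p) ^ 2 := by
  have hk : (k : ℂ) + 2 ≠ 0 := by exact_mod_cast Nat.succ_ne_zero (k + 1)
  have hJp := hJ.self_of_nhds
  have hsyz := covT_hasDerivAt_syzygy hF (φ p)
  have hder := hasDerivAt_invJ hF hf hh
  have hderP := fun hfP => (hasDerivAt_invJ hF (p := φ p) hfP hhP).comp p hφ.hasDerivAt
  rw [invJ, invJ] at hJp
  rw [invK, invK] at hK
  set t := inhom (covT F) p
  set tP := inhom (covT F) (φ p)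
  set h := inhom (covH F) p
  set hP := inhom (covH F) (φ p)
  set f := inhom F p
  set fP := inhom F (φ p)
  set U := inhom (covU F) p
  set UP := inhom (covU F) (φ p)
  set d := deriv φ p
  have ht : t ≠ 0 := left_ne_zero_of_mul hW
  have hw : 3 * t ^ 2 - 2 * h * U ≠ 0 := right_ne_zero_of_mul hW
  rw [div_eq_div_iff (pow_ne_zero 3 hhP) (pow_ne_zero 3 hh)] at hJp
  rw [div_eq_div_iff (pow_ne_zero 2 hhP) (pow_ne_zero 2 hh)] at hK
  have htP : tP ≠ 0 := by
    intro h0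
    rw [h0] at hJp
    exact mul_ne_zero (pow_ne_zero 2 ht) (pow_ne_zero 3 hhP) (by rw [← hJp]; ring)
  -- Equality of 3J - 2K at p and φ(p), cleared of denominators.
  have hww : (3 * tP ^ 2 - 2 * hP * UP) * h ^ 3 = (3 * t ^ 2 - 2 * h * U) * hP ^ 3 := by
    linear_combination 3 * hJp - 2 * hP * h * hK
  have hwP : 3 * tP ^ 2 - 2 * hP * UP ≠ 0 := by
    intro h0
    rw [h0] at hww
    exact mul_ne_zero hw (pow_ne_zero 3 hhP) (by rw [← hww]; ring)
  -- At a zero of f the syzygy would force t (3t² - 2hu) = 0. This is needed before J can be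
  -- differentiated at φ(p) by `hasDerivAt_invJ`.
  have hfP : fP ≠ 0 := by
    intro h0
    rw [h0] at hsyz
    exact mul_ne_zero htP hwP (by rw [← hsyz]; ring)
  have hd := ((hderP hfP).congr_of_eventuallyEq (f₁ := invJ F)
    (hJ.mono fun q hq => hq.symm)).unique hder
  have S1 : tP * d * h * f = t * hP * fP := by
    have hd' : tP * (3 * tP ^ 2 - 2 * hP * UP) * d * (f * h ^ 4)
        = t * (3 * t ^ 2 - 2 * h * U) * (fP * hP ^ 4) := by
      rw [div_mul_eq_mul_div, div_eq_div_iff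
        (mul_ne_zero (mul_ne_zero hk hfP) (pow_ne_zero 4 hhP))
        (mul_ne_zero (mul_ne_zero hk hf) (pow_ne_zero 4 hh))] at hd
      apply mul_left_cancel₀ hk
      linear_combination hd
    apply mul_left_cancel₀ (mul_ne_zero hwP (pow_ne_zero 3 hh))
    linear_combination hd' - t * hP * fP * hww
  have hd0 : d ≠ 0 := by
    intro h0
    rw [h0] at S1
    exact mul_ne_zero (mul_ne_zero ht hhP) hfP (by rw [← S1]; ring)
  refine ⟨hfP, hd0, S1, ?_⟩
  apply mul_left_cancel₀ (mul_ne_zero (pow_ne_zero 2 htP) (pow_ne_zero 2 hh))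
  linear_combination hP * (tP * d * h * f + t * hP * fP) * S1 - fP ^ 2 * hJp

/-- The logarithmic derivatives of `F` and of `φ'` along a solution of the symmetry equations. -/
lemma logDeriv_of_symmetryEquations {F : MvPolynomial (Fin 2) ℂ} {k : ℕ}
    (hF : F.IsHomogeneous (k + 2)) {φ : ℂ → ℂ} {B : Set ℂ} (hB : IsOpen B)
    (hφ : AnalyticOnNhd ℂ φ B) (hh : ∀ p ∈ B, inhom (covH F) p ≠ 0)
    (hhP : ∀ p ∈ B, inhom (covH F) (φ p) ≠ 0) (hf : ∀ p ∈ B, inhom F p ≠ 0)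
    (hfP : ∀ p ∈ B, inhom F (φ p) ≠ 0) (hd : ∀ p ∈ B, deriv φ p ≠ 0)
    (S1 : ∀ p ∈ B, inhom (covT F) (φ p) * deriv φ p * inhom (covH F) p * inhom F p
        = inhom (covT F) p * inhom (covH F) (φ p) * inhom F (φ p))
    (S2 : ∀ p ∈ B, deriv φ p ^ 2 * inhom (covH F) (φ p) * inhom F p ^ 2
        = inhom (covH F) p * inhom F (φ p) ^ 2) {p : ℂ} (hp : p ∈ B) :
    inhom (pderiv 0 F) (φ p) * deriv φ p / inhom F (φ p) =
      inhom (pderiv 0 F) p / inhom F p + (k + 2) / 2 * (deriv (deriv φ) p / deriv φ p) := by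
  have hφd := (hφ p hp).differentiableAt.hasDerivAt
  have hφdd := (hφ.deriv p hp).differentiableAt.hasDerivAt
  have l := ((hφdd.pow 2).mul ((hasDerivAt_inhom (covH F) (φ p)).comp p hφd)).mul
    ((hasDerivAt_inhom F p).pow 2)
  have r := (hasDerivAt_inhom (covH F) p).mul (((hasDerivAt_inhom F (φ p)).comp p hφd).pow 2)
  have e := (l.congr_of_eventuallyEq (Filter.eventuallyEq_of_mem (hB.mem_nhds hp)
      fun q hq => (S2 q hq).symm)).unique r
  have hT : inhom (covT F) p = _ := inhom_jacobian hF (isHomogeneous_covH hF) p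
  have hTP : inhom (covT F) (φ p) = _ := inhom_jacobian hF (isHomogeneous_covH hF) (φ p)
  have s1 := S1 p hp
  have s2 := S2 p hp
  have nh := hh p hp
  have nhP := hhP p hp
  have nf := hf p hp
  have nfP := hfP p hp
  have nd := hd p hp
  rw [hT, hTP] at s1
  simp only [Pi.mul_apply, Pi.pow_apply, Function.comp_apply] at e
  push_cast at s1 e
  set h := inhom (covH F) p
  set hP := inhom (covH F) (φ p)
  set h' := inhom (pderiv 0 (covH F)) p
  set hP' := inhom (pderiv 0 (covH F)) (φ p)
  set f := inhom F p
  set fP := inhom F (φ p)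
  set f' := inhom (pderiv 0 F) p
  set fP' := inhom (pderiv 0 F) (φ p)
  set d := deriv φ p
  set d' := deriv (deriv φ) p
  have s1' : 2 * k * (fP' * d / fP - f' / f) = (k + 2) * (hP' * d / hP - h' / h) := by
    field_simp
    linear_combination s1
  have e' : 2 * (d' / d) + hP' * d / hP + 2 * (f' / f) = h' / h + 2 * (fP' * d / fP) := by
    have hne : d ^ 2 * hP * f ^ 2 ≠ 0 :=
      mul_ne_zero (mul_ne_zero (pow_ne_zero 2 nd) nhP) (pow_ne_zero 2 nf)
    have e1 : d ^ 2 * hP * f ^ 2 * (2 * (d' / d) + hP' * d / hP + 2 * (f' / f)) =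
        (2 * d * d' * hP + d ^ 2 * (hP' * d)) * f ^ 2 + d ^ 2 * hP * (2 * f * f') := by
      field_simp
    have e2 : h * fP ^ 2 * (h' / h + 2 * (fP' * d / fP)) =
        h' * fP ^ 2 + h * (2 * fP * (fP' * d)) := by
      field_simp
    apply mul_left_cancel₀ hne
    linear_combination e1 - e2 + e - (h' / h + 2 * (fP' * d / fP)) * s2
  -- Eliminates the difference of logarithmic derivatives of h ∘ φ and h; the remaining coefficient
  -- is 2k - 2n = -4, nonzero for every degree.
  linear_combination (-1 / 4) * s1' - (k + 2) / 4 * e'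

/-- Differentiating `R` gives one relation between the second derivatives of f at p and φ(p), and
`S2` with h expanded gives another. Eliminating them, and then f' through `R`, leaves only the
Schwarzian. -/
lemma schwarzian_eq_zero_of_symmetryEquations {F : MvPolynomial (Fin 2) ℂ} {k : ℕ}
    (hF : F.IsHomogeneous (k + 2)) {φ : ℂ → ℂ} {B : Set ℂ} (hB : IsOpen B)
    (hφ : AnalyticOnNhd ℂ φ B) (hf : ∀ p ∈ B, inhom F p ≠ 0)
    (hfP : ∀ p ∈ B, inhom F (φ p) ≠ 0) (hd : ∀ p ∈ B, deriv φ p ≠ 0)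
    (S2 : ∀ p ∈ B, deriv φ p ^ 2 * inhom (covH F) (φ p) * inhom F p ^ 2
        = inhom (covH F) p * inhom F (φ p) ^ 2)
    (R : ∀ p ∈ B, inhom (pderiv 0 F) (φ p) * deriv φ p / inhom F (φ p) =
      inhom (pderiv 0 F) p / inhom F p + (k + 2) / 2 * (deriv (deriv φ) p / deriv φ p))
    {p : ℂ} (hp : p ∈ B) :
    2 * deriv (deriv (deriv φ)) p * deriv φ p = 3 * deriv (deriv φ) p ^ 2 := by
  have hk1 : (k : ℂ) + 1 ≠ 0 := Nat.cast_add_one_ne_zero k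
  have hk : (k : ℂ) + 2 ≠ 0 := by exact_mod_cast Nat.succ_ne_zero (k + 1)
  have h0 := (hφ p hp).differentiableAt.hasDerivAt
  have h1 := (hφ.deriv p hp).differentiableAt.hasDerivAt
  have h2 := (hφ.deriv.deriv p hp).differentiableAt.hasDerivAt
  have nf := hf p hp
  have nfP := hfP p hp
  have nd := hd p hp
  have l := (((hasDerivAt_inhom (pderiv 0 F) (φ p)).comp p h0).mul h1).div
    ((hasDerivAt_inhom F (φ p)).comp p h0) nfP
  have r := ((hasDerivAt_inhom (pderiv 0 F) p).div (hasDerivAt_inhom F p) nf).add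
    ((h2.div h1 nd).const_mul (((k : ℂ) + 2) / 2))
  have e := (l.congr_of_eventuallyEq (Filter.eventuallyEq_of_mem (hB.mem_nhds hp)
      fun q hq => (R q hq).symm)).unique r
  have s2 := S2 p hp
  have r0 := R p hp
  rw [inhom_covH hF, inhom_covH hF] at s2
  simp only [Pi.mul_apply, Function.comp_apply] at e
  set f := inhom F p
  set fP := inhom F (φ p)
  set f' := inhom (pderiv 0 F) p
  set fP' := inhom (pderiv 0 F) (φ p)
  set f'' := inhom (pderiv 0 (pderiv 0 F)) p
  set fP'' := inhom (pderiv 0 (pderiv 0 F)) (φ p)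
  set d := deriv φ p
  set d' := deriv (deriv φ) p
  set d'' := deriv (deriv (deriv φ)) p
  have s2' : (k + 2) * (fP'' * d ^ 2 / fP - f'' / f)
      = (k + 1) * ((fP' * d / fP) ^ 2 - (f' / f) ^ 2) := by
    field_simp
    apply mul_left_cancel₀ hk1
    linear_combination s2
  have e' : fP'' * d ^ 2 / fP + fP' * d / fP * (d' / d) - (fP' * d / fP) ^ 2 =
      f'' / f - (f' / f) ^ 2 + (k + 2) / 2 * (d'' / d - (d' / d) ^ 2) := by
    refine Eq.trans ?_ (e.trans ?_)
    · field_simp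
    · field_simp
  have w : 2 * (d'' / d) = 3 * (d' / d) ^ 2 := by
    apply mul_left_cancel₀ (pow_ne_zero 2 hk)
    linear_combination 4 * s2' - 4 * (k + 2) * e'
      - (4 * (fP' * d / fP + f' / f) - 2 * (k + 2) * (d' / d)) * r0
  field_simp at w
  linear_combination w

lemma inhom_linSubst {Q : MvPolynomial (Fin 2) ℂ} {m : ℕ} (hQ : Q.IsHomogeneous m)
    (A : Matrix (Fin 2) (Fin 2) ℂ) {p : ℂ} (hp : A 1 0 * p + A 1 1 ≠ 0) :
    inhom (linSubst A Q) p = (A 1 0 * p + A 1 1) ^ m *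
      inhom Q ((A 0 0 * p + A 0 1) / (A 1 0 * p + A 1 1)) := by
  have e : ∀ i, A.mulVec ![p, 1] i = A i 0 * p + A i 1 := by
    intro i
    simp [Matrix.mulVec, dotProduct, Fin.sum_univ_two]
  rw [inhom, eval_linSubst, eval_eq_pow_mul_inhom hQ (by rwa [e]), e, e]

/-- A solution of the symmetry equations of a nonsingular form is a linear fractional
transformation `φ`, and `F ∘ A` is proportional to `F` for its matrix `A`. -/
lemma exists_linearFractional_of_solves {F : MvPolynomial (Fin 2) ℂ} {k : ℕ}
    (hF : F.IsHomogeneous (k + 2)) (hns : Nonsingular F) {D : Set ℂ} (hD : IsOpen D)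
    (hDc : IsPreconnected D) {φ : ℂ → ℂ} (hφ : AnalyticOnNhd ℂ φ D)
    (hsol : SolvesSymmetryEquations F D φ) :
    ∃ (A : Matrix (Fin 2) (Fin 2) ℂ) (c : ℂ), A.det ≠ 0 ∧ c ≠ 0 ∧ linSubst A F = C c * F ∧
      ∀ p ∈ D, φ p * (A 1 0 * p + A 1 1) = A 0 0 * p + A 0 1 := by
  have hH0 := covH_ne_zero hF hns
  have hF0 : F ≠ 0 := by
    rintro rfl
    simp [covH] at hH0
  obtain ⟨⟨p₁, hp₁D, hp₁, hp₁P⟩, heq⟩ := hsol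
  have hcont : ∀ Q, Continuous (inhom Q) := fun Q =>
    continuous_iff_continuousAt.mpr fun p => (analyticAt_inhom Q p).continuousAt
  let V : Set ℂ := {p | p ∈ D ∧ inhom (covH F) p ≠ 0 ∧ inhom (covH F) (φ p) ≠ 0}
  have hV : ∀ p ∈ V, V ∈ nhds p := by
    rintro p ⟨hpD, hp, hpP⟩
    have hc := (hφ p hpD).continuousAt
    filter_upwards [hD.mem_nhds hpD, (hcont (covH F)).continuousAt.eventually_ne hp,
      ((hcont (covH F)).continuousAt.comp hc).eventually_ne hpP] with q h1 h2 h3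
    exact ⟨h1, h2, h3⟩
  have hVo : IsOpen V := isOpen_iff_mem_nhds.mpr hV
  -- W is the numerator of J' up to powers of f and h; a point with F W ≠ 0 is one where the
  -- cancellations are legitimate.
  let W : MvPolynomial (Fin 2) ℂ := covT F * (C 3 * covT F ^ 2 - C 2 * (covH F * covU F))
  have hWh : W.IsHomogeneous (3 * k + 3 * k * 2) := by
    refine (isHomogeneous_covT hF).mul ((((isHomogeneous_covT hF).pow 2).C_mul 3).sub ?_)
    have := ((isHomogeneous_covH hF).mul (isHomogeneous_covU hF)).C_mul 2
    rwa [show 2 * k + 4 * k = 3 * k * 2 by ring] at this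
  have hWe : ∀ p, inhom W p = inhom (covT F) p * (3 * inhom (covT F) p ^ 2
      - 2 * inhom (covH F) p * inhom (covU F) p) := by
    intro p
    simp [W, inhom]
    ring_nf
    simp
  have hW0 : W ≠ 0 := fun h0 => not_nonsingular_of_invJ_const hF hF0 hH0
    (fun p => by rw [← hWe, h0]; simp [inhom]) hns
  obtain ⟨p₀, hp₀V, hp₀⟩ := exists_inhom_ne_zero (hF.mul hWh) (mul_ne_zero hF0 hW0) hVo
    ⟨p₁, hp₁D, hp₁, hp₁P⟩
  rw [inhom_mul] at hp₀
  obtain ⟨B, hB, hBc, hpB, hall⟩ := exists_ball_of_eventually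
    ((show ∀ᶠ p in nhds p₀, p ∈ V from hV p₀ hp₀V).and
      (((hcont F).continuousAt.eventually_ne (left_ne_zero_of_mul hp₀)).and
      ((hcont W).continuousAt.eventually_ne (right_ne_zero_of_mul hp₀))))
  choose hBV hf hWB using hall
  have hφB : AnalyticOnNhd ℂ φ B := fun p hp => hφ p (hBV p hp).1
  have hreg := fun p (hp : p ∈ B) => symmetryEquations_regular hF (hφB p hp).differentiableAt
    (hBV p hp).2.1 (hBV p hp).2.2 (hf p hp) (by rw [← hWe]; exact hWB p hp)
    (Filter.mem_of_superset (hB.mem_nhds hp) fun q hq =>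
      (heq q (hBV q hq).1 (hBV q hq).2.1 (hBV q hq).2.2).1)
    (heq p (hBV p hp).1 (hBV p hp).2.1 (hBV p hp).2.2).2
  choose hfP hd S1 S2 using hreg
  have R := fun p (hp : p ∈ B) => logDeriv_of_symmetryEquations hF hB hφB (fun p hp => (hBV p hp).2.1)
    (fun p hp => (hBV p hp).2.2) hf hfP hd S1 S2 hp
  obtain ⟨κ, hκ⟩ := linearFractional_of_schwarzian_eq_zero hB hBc hφB hd (fun p hp =>
    schwarzian_eq_zero_of_symmetryEquations hF hB hφB hf hfP hd S2 R hp) hpB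
  choose hκ1 hden hmob using hκ
  have hL : ∀ p, HasDerivAt (fun p => 1 - κ * (p - p₀)) (-κ) p := fun p =>
    ((((hasDerivAt_id p).sub_const p₀).const_mul κ).const_sub 1).congr_deriv (by simp)
  -- The logarithmic derivative of f(φ) (1 - κ(p - p₀))^n / f vanishes by `R` and φ'' (1 - κ(p -
  -- p₀)) = 2κφ'.
  have hconst : ∀ p ∈ B, inhom F (φ p) * (1 - κ * (p - p₀)) ^ (k + 2) =
      inhom F (φ p₀) / inhom F p₀ * inhom F p := by
    intro p hp
    have := eq_of_hasDerivAt_zero hB hBc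
      (g := fun p => inhom F (φ p) * (1 - κ * (p - p₀)) ^ (k + 2) / inhom F p) (fun q hq => by
        have h0 := (hφB q hq).differentiableAt.hasDerivAt
        refine ((((hasDerivAt_inhom F (φ q)).comp q h0).mul ((hL q).pow (k + 2))).div
          (hasDerivAt_inhom F q) (hf q hq)).congr_deriv ?_
        have r0 := R q hq
        have k1 := hκ1 q hq
        have n1 := hf q hq
        have n2 := hfP q hq
        have n3 := hd q hq
        simp only [Pi.mul_apply, Pi.pow_apply, Function.comp_apply]
        rw [div_eq_zero_iff]
        left
        simp only [Nat.add_succ_sub_one, pow_succ]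
        field_simp at r0
        push_cast
        apply mul_left_cancel₀ (mul_ne_zero two_ne_zero n3)
        linear_combination (1 - κ * (q - p₀)) ^ (k + 1) * (1 - κ * (q - p₀)) * r0
          + (1 - κ * (q - p₀)) ^ (k + 1) * (k + 2) * inhom F q * inhom F (φ q) * k1) hp hpB
    simp only [sub_self, mul_zero, sub_zero, one_pow, mul_one] at this
    rw [← this]
    exact (div_mul_cancel₀ _ (hf p hp)).symm
  have hD1 : ∀ p ∈ D, φ p * (1 - κ * (p - p₀)) = φ p₀ + (deriv φ p₀ - κ * φ p₀) * (p - p₀) := by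
    have a1 : AnalyticOnNhd ℂ (fun p => φ p * (1 - κ * (p - p₀))) D := fun p hp =>
      (hφ p hp).mul (by fun_prop)
    have a2 : AnalyticOnNhd ℂ (fun p => φ p₀ + (deriv φ p₀ - κ * φ p₀) * (p - p₀)) D :=
      fun p hp => by fun_prop
    exact a1.eqOn_of_preconnected_of_eventuallyEq a2 hDc hp₀V.1
      (Filter.eventuallyEq_of_mem (hB.mem_nhds hpB) hmob)
  -- Coefficients of the numerator and denominator in `hmob`; the determinant is φ'(p₀).
  refine ⟨!![deriv φ p₀ - κ * φ p₀, φ p₀ - (deriv φ p₀ - κ * φ p₀) * p₀; -κ, 1 + κ * p₀],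
    inhom F (φ p₀) / inhom F p₀, ?_, div_ne_zero (hfP p₀ hpB) (hf p₀ hpB), ?_, ?_⟩
  · rw [Matrix.det_fin_two_of]
    convert hd p₀ hpB using 1
    ring
  · rw [← sub_eq_zero]
    refine eq_zero_of_isOpen ((isHomogeneous_linSubst _ hF).sub (hF.C_mul _)) hB ⟨p₀, hpB⟩
      fun p hp => ?_
    have e : ∀ Q : MvPolynomial (Fin 2) ℂ, inhom (Q - C (inhom F (φ p₀) / inhom F p₀) * F) p =
        inhom Q p - inhom F (φ p₀) / inhom F p₀ * inhom F p := by
      intro Q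
      simp only [inhom, map_sub, map_mul, eval_C]
    have e1 : -κ * p + (1 + κ * p₀) = 1 - κ * (p - p₀) := by ring
    have hn := hden p hp
    rw [e, sub_eq_zero, ← hconst p hp, inhom_linSubst hF]
    · simp only [Matrix.of_apply, Matrix.cons_val', Matrix.cons_val_zero, Matrix.cons_val_one,
        Matrix.cons_val_fin_one, e1]
      rw [mul_comm]
      congr 2
      rw [div_eq_iff hn]
      linear_combination -hmob p hp
    · simp only [Matrix.of_apply, Matrix.cons_val', Matrix.cons_val_zero, Matrix.cons_val_one,
        Matrix.cons_val_fin_one, e1]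
      exact hn
  · intro p hp
    simp only [Matrix.of_apply, Matrix.cons_val', Matrix.cons_val_zero, Matrix.cons_val_one,
      Matrix.cons_val_fin_one]
    linear_combination hD1 p hp

/-! ### Passage to the projective symmetry group, and the converse. -/

lemma exists_mem_projectiveSymmetryGroup {F : MvPolynomial (Fin 2) ℂ} {n : ℕ} (hn : n ≠ 0)
    (hF : F.IsHomogeneous n) {A : Matrix (Fin 2) (Fin 2) ℂ} {c : ℂ} (hA : A.det ≠ 0)
    (hc : c ≠ 0) (h : linSubst A F = C c * F) {D : Set ℂ} {φ : ℂ → ℂ}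
    (hφ : ∀ p ∈ D, φ p * (A 1 0 * p + A 1 1) = A 0 0 * p + A 0 1) :
    ∃ g ∈ projectiveSymmetryGroup F, IsLinearFractionalOn g D φ := by
  obtain ⟨μ, hμ⟩ := IsAlgClosed.exists_pow_nat_eq c⁻¹ (Nat.pos_of_ne_zero hn)
  have hμ0 : μ ≠ 0 := by
    rintro rfl
    rw [zero_pow hn] at hμ
    exact inv_ne_zero hc hμ.symm
  have hdet : (μ • A).det ≠ 0 := by
    rw [Matrix.det_smul]
    exact mul_ne_zero (pow_ne_zero _ hμ0) hA
  let G : GL (Fin 2) ℂ := Matrix.GeneralLinearGroup.mkOfDetNeZero (μ • A) hdet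
  have hG : (G : Matrix (Fin 2) (Fin 2) ℂ) = μ • A := rfl
  refine ⟨Matrix.ProjGenLinGroup.mk G, Subgroup.mem_map_of_mem _ ?_, G, rfl, fun p hp => ?_⟩
  · intro x
    rw [hG, Matrix.smul_mulVec, eval_smul_of_isHomogeneous hF, ← eval_linSubst, h, hμ]
    simp [hc]
  -- A zero of the denominator would, by `hφ`, be a zero of the numerator, putting (p, 1) in the
  -- kernel of A.
  · have hA' : A 1 0 * p + A 1 1 ≠ 0 := by
      intro h0
      have h1 := hφ p hp
      rw [h0, mul_zero] at h1
      rw [Matrix.det_fin_two] at hA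
      by_cases h10 : A 1 0 = 0
      · have : A 1 1 = 0 := by simpa [h10] using h0
        simp [h10, this] at hA
      · apply hA
        apply mul_left_cancel₀ h10
        linear_combination A 0 0 * A 1 0 * h0 + A 1 0 ^ 2 * h1
    rw [hG]
    simp only [Matrix.smul_apply, smul_eq_mul]
    have e1 : μ * A 1 0 * p + μ * A 1 1 = μ * (A 1 0 * p + A 1 1) := by ring
    have e2 : μ * A 0 0 * p + μ * A 0 1 = μ * (A 0 0 * p + A 0 1) := by ring
    rw [e1, e2, mul_div_mul_left _ _ hμ0, eq_div_iff hA']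
    exact ⟨mul_ne_zero hμ0 hA', hφ p hp⟩

lemma solves_of_isLinearFractionalOn {F : MvPolynomial (Fin 2) ℂ} {k : ℕ}
    (hF : F.IsHomogeneous (k + 2)) (hns : Nonsingular F) {D : Set ℂ} (hD : IsOpen D)
    (hDn : D.Nonempty) {φ : ℂ → ℂ} {g : Matrix.ProjGenLinGroup (Fin 2) ℂ}
    (hg : g ∈ projectiveSymmetryGroup F) (hφ : IsLinearFractionalOn g D φ) :
    SolvesSymmetryEquations F D φ := by
  obtain ⟨G, hG, rfl⟩ := hg
  obtain ⟨A, hA, hAφ⟩ := hφ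
  -- The matrix describing φ need not preserve F, only some scalar multiple of it does; the scalar u
  -- drops out of the fraction.
  obtain ⟨u, rfl⟩ := Matrix.ProjGenLinGroup.mk_eq_mk_iff.mp hA.symm
  have hent : ∀ i j, (G * Matrix.GeneralLinearGroup.scalar (Fin 2) u) i j = u * G i j := by
    intro i j
    simp [Matrix.mul_apply, Matrix.scalar_apply, Matrix.diagonal_apply, mul_comm]
  simp only [hent] at hAφ
  have hden : ∀ p ∈ D, G 1 0 * p + G 1 1 ≠ 0 := by
    intro p hp h0
    apply (hAφ p hp).1
    linear_combination (u : ℂ) * h0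
  have hval : ∀ p ∈ D, φ p = (G 0 0 * p + G 0 1) / (G 1 0 * p + G 1 1) := by
    intro p hp
    rw [(hAφ p hp).2, mul_assoc, mul_assoc, ← mul_add, ← mul_add, mul_div_mul_left _ _ u.ne_zero]
  have hinv : linSubst G F = F := MvPolynomial.funext fun x => by rw [eval_linSubst]; exact hG x
  have hdet : (G : Matrix (Fin 2) (Fin 2) ℂ).det ≠ 0 := by
    have := (Matrix.GeneralLinearGroup.det G).ne_zero
    simpa using this
  have htrans : ∀ {Q : MvPolynomial (Fin 2) ℂ} {m : ℕ}, Q.IsHomogeneous m → ∀ p ∈ D,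
      inhom (linSubst G Q) p = (G 1 0 * p + G 1 1) ^ m * inhom Q (φ p) := by
    intro Q m hQ p hp
    rw [inhom_linSubst hQ _ (hden p hp), hval p hp]
  have hC : ∀ (c : ℂ) Q p, inhom (C c * Q) p = c * inhom Q p := by simp [inhom]
  set d := (G : Matrix (Fin 2) (Fin 2) ℂ).det
  have hH : ∀ p ∈ D, inhom (covH F) p =
      d ^ 2 * ((G 1 0 * p + G 1 1) ^ (2 * k) * inhom (covH F) (φ p)) := by
    intro p hp
    rw [← htrans (isHomogeneous_covH hF) p hp, ← hC, ← covH_linSubst, hinv]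
  have hT : ∀ p ∈ D, inhom (covT F) p =
      d ^ 3 * ((G 1 0 * p + G 1 1) ^ (3 * k) * inhom (covT F) (φ p)) := by
    intro p hp
    rw [← htrans (isHomogeneous_covT hF) p hp, ← hC, ← covT_linSubst, hinv]
  have hU : ∀ p ∈ D, inhom (covU F) p =
      d ^ 4 * ((G 1 0 * p + G 1 1) ^ (4 * k) * inhom (covU F) (φ p)) := by
    intro p hp
    rw [← htrans (isHomogeneous_covU hF) p hp, ← hC, ← covU_linSubst, hinv]
  refine ⟨?_, fun p hp _ hhP => ⟨?_, ?_⟩⟩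
  · obtain ⟨p, hp, hne⟩ := exists_inhom_ne_zero (isHomogeneous_covH hF) (covH_ne_zero hF hns) hD hDn
    refine ⟨p, hp, hne, fun h0 => hne ?_⟩
    rw [hH p hp, h0, mul_zero, mul_zero]
  · have hw := hden p hp
    rw [invJ, invJ, hH p hp, hT p hp]
    field_simp
    ring
  · have hw := hden p hp
    rw [invK, invK, hH p hp, hU p hp]
    field_simp
    ring

end BinaryForm

end

theorem mainTheorem9 (n : ℕ) (F : MvPolynomial (Fin 2) ℂ) (hF : F.IsHomogeneous n)
    (hns : BinaryForm.Nonsingular F)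
    (D : Set ℂ) (hD : IsOpen D) (hDc : IsConnected D)
    (φ : ℂ → ℂ) (hφ : AnalyticOnNhd ℂ φ D) :
    BinaryForm.SolvesSymmetryEquations F D φ ↔
      ∃ g ∈ BinaryForm.projectiveSymmetryGroup F, BinaryForm.IsLinearFractionalOn g D φ := by
  obtain ⟨k, rfl⟩ : ∃ k, n = k + 2 := by
    rcases Nat.lt_or_ge n 2 with h | h
    · exact absurd hns (BinaryForm.not_nonsingular_of_le_one hF (by omega))
    · exact ⟨n - 2, by omega⟩
  constructor
  · intro hsol
    obtain ⟨A, c, hA, hc, hAF, hφA⟩ :=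
      BinaryForm.exists_linearFractional_of_solves hF hns hD hDc.isPreconnected hφ hsol
    exact BinaryForm.exists_mem_projectiveSymmetryGroup (by omega) hF hA hc hAF hφA
  · rintro ⟨g, hg, hφg⟩
    exact BinaryForm.solves_of_isLinearFractionalOn hF hns hD hDc.nonempty hg hφg
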